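/- Theorem 1.2 (Bobenko–Pinkall–Springborn). Let $M$ be a connected closed surface with a finite triangulation $\mathcal T=(V,E,F)$ ($M$ is cut into triangles glued along whole sides; this includes every triangulation by a simplicial complex, and two sides or two corners of one triangle are allowed to be identified). A discrete metric is a function $l:E\to(0,\infty)$ such that the three sides of every face satisfy the strict triangle inequalities. Regarding each face as a Euclidean (respectively hyperbolic, of curvature $-1$) triangle with these side lengths, $l$ is called a PL (respectively PH) metric; its combinatorial curvature $K_v(l)$ at $v\in V$ is $2\pi$ minus the sum of the inner angles at all corners of faces located at $v$. Fix a discrete metric $\tilde l$. For $u:V\to\mathbb R$, a discrete metric $l$ is the Euclidean vertex scaling of $\tilde l$ with discrete conformal factor $u$ if $l_e=\tilde l_e\,e^{(u_i+u_j)/2}$ for every edge $e$ with end points $v_i,v_j$, and the hyperbolic vertex scaling of $\tilde l$ with discrete conformal factor $u$ if $\sinh\frac{l_e}{2}=\sinh\frac{\tilde l_e}{2}\,e^{(u_i+u_j)/2}$ for every such $e$. Then the discrete conformal factor is determined by the combinatorial curvature, up to a constant in the PL case: (1) (PL case) Let $l$ be the Euclidean vertex scaling of $\tilde l$ with factor $u$,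 and let $u':V\to\mathbb R$. There is a Euclidean vertex scaling $l'$ of $\tilde l$ with factor $u'$ and $K_v(l')=K_v(l)$ for all $v\in V$ if and only if $u'=u+t(1,\dots,1)$ for some $t\in\mathbb R$. (2) (PH case) If $l$ and $l'$ are the hyperbolic vertex scalings of $\tilde l$ with factors $u$ and $u'$, and $K_v(l)=K_v(l')$ for all $v\in V$, then $u=u'$. -/

import Mathlib

/-- The open standard `n`-simplex: the points all of whose barycentric coordinates are positive. -/
def OpenSimplex (n : ℕ) : Type :=
  {x : stdSimplex ℝ (Fin (n + 1)) // ∀ i, 0 < x i}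

/-- A triangulation of a space `M` with vertex set `V`, edge set `E` and face set `F`:
`M` is cut into (images of) triangles glued to each other along whole sides, affinely.
Two sides, or two corners, of one triangle may be glued to each other; every triangulation by a
simplicial complex is of this kind (order the vertices of each edge and each face arbitrarily). -/
structure SurfaceTriangulation (V E F M : Type*) [TopologicalSpace M] where
  /-- the point of `M` at a vertex -/
  vertexPoint : V → M
  /-- the characteristic map of an edge -/
  edgeMap : E → C(stdSimplex ℝ (Fin 2), M)
  /-- the characteristic map of a face -/
  faceMap : F → C(stdSimplex ℝ (Fin 3), M)
  /-- the two end points of an edge -/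
  ends : E → Fin 2 → V
  /-- the three corners of a face -/
  corner : F → Fin 3 → V
  /-- the three sides of a face; `side f i` is opposite to `corner f i` -/
  side : F → Fin 3 → E
  edgeMap_vertex : ∀ e a, edgeMap e (stdSimplex.vertex a) = vertexPoint (ends e a)
  faceMap_vertex : ∀ f i, faceMap f (stdSimplex.vertex i) = vertexPoint (corner f i)
  /-- On the side opposite to corner `i`, the map of a face is the map of the edge `side f i`,
  up to exchanging the two end points. -/
  faceMap_side : ∀ f i, ∃ σ : Equiv.Perm (Fin 2), ∀ x : stdSimplex ℝ (Fin 2),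
    faceMap f (stdSimplex.map (fun a => i.succAbove (σ a)) x) = edgeMap (side f i) x
  /-- Each point of `M` is exactly one of the following: a vertex, an interior point of exactly
  one edge (at one parameter), an interior point of exactly one face (at one parameter). -/
  cells_bijective : Function.Bijective
    (Sum.elim vertexPoint
      (Sum.elim (fun p : E × OpenSimplex 1 => edgeMap p.1 p.2.1)
        (fun p : F × OpenSimplex 2 => faceMap p.1 p.2.1)))
  /-- `M` is the union of the closed triangles. -/
  faces_cover : ∀ p : M, ∃ f x, faceMap f x = p

/-- The inner angle, opposite to the side of length `a`, of the Euclidean triangle with side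
lengths `a`, `b`, `c` (law of cosines). -/
noncomputable def euclideanAngle (a b c : ℝ) : ℝ :=
  Real.arccos ((b ^ 2 + c ^ 2 - a ^ 2) / (2 * b * c))

/-- The inner angle, opposite to the side of length `a`, of the triangle in the hyperbolic plane
of curvature `-1` with side lengths `a`, `b`, `c` (hyperbolic law of cosines). -/
noncomputable def hyperbolicAngle (a b c : ℝ) : ℝ :=
  Real.arccos ((Real.cosh b * Real.cosh c - Real.cosh a) / (Real.sinh b * Real.sinh c))

namespace SurfaceTriangulation

variable {V E F M : Type*} [TopologicalSpace M]

/-- A discrete metric: positive edge lengths satisfying the strict triangle inequalities on each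
face. The index `i + 1` is taken modulo `3`. The same functions describe PL metrics (faces are
Euclidean triangles) and PH metrics (faces are hyperbolic triangles). -/
def IsDiscreteMetric (T : SurfaceTriangulation V E F M) (l : E → ℝ) : Prop :=
  (∀ e, 0 < l e) ∧
    ∀ f (i : Fin 3), l (T.side f i) < l (T.side f (i + 1)) + l (T.side f (i + 2))

open Classical in
/-- The combinatorial curvature at `v`, for a rule `angle` giving the inner angles of a triangle
in terms of its side lengths: `2π` minus the sum of the inner angles at all corners at `v`. -/
noncomputable def curvature [Fintype F] (T : SurfaceTriangulation V E F M)
    (angle : ℝ → ℝ → ℝ → ℝ) (l : E → ℝ) (v : V) : ℝ :=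
  2 * Real.pi - ∑ f : F, ∑ i : Fin 3,
    if T.corner f i = v then
      angle (l (T.side f i)) (l (T.side f (i + 1))) (l (T.side f (i + 2)))
    else 0

/-- The combinatorial curvature of a PL metric. -/
noncomputable def curvaturePL [Fintype F] (T : SurfaceTriangulation V E F M) (l : E → ℝ) :
    V → ℝ :=
  T.curvature euclideanAngle l

/-- The combinatorial curvature of a PH metric. -/
noncomputable def curvaturePH [Fintype F] (T : SurfaceTriangulation V E F M) (l : E → ℝ) :
    V → ℝ :=
  T.curvature hyperbolicAngle l

/-- `l` is the Euclidean vertex scaling of `l₀` with discrete conformal factor `u`. -/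
def IsEuclideanVertexScaling (T : SurfaceTriangulation V E F M) (l₀ : E → ℝ) (u : V → ℝ)
    (l : E → ℝ) : Prop :=
  T.IsDiscreteMetric l₀ ∧ T.IsDiscreteMetric l ∧
    ∀ e, l e = l₀ e * Real.exp ((u (T.ends e 0) + u (T.ends e 1)) / 2)

/-- `l` is the hyperbolic vertex scaling of `l₀` with discrete conformal factor `u`. -/
def IsHyperbolicVertexScaling (T : SurfaceTriangulation V E F M) (l₀ : E → ℝ) (u : V → ℝ)
    (l : E → ℝ) : Prop :=
  T.IsDiscreteMetric l₀ ∧ T.IsDiscreteMetric l ∧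
    ∀ e, Real.sinh (l e / 2) =
      Real.sinh (l₀ e / 2) * Real.exp ((u (T.ends e 0) + u (T.ends e 1)) / 2)

end SurfaceTriangulation

/-! Put `d = u' - u`. Summation by parts turns the pairing of `d` with the difference of curvatures
into a sum over faces of `x ΔA + y ΔB + z ΔC`, where `x, y, z` are the values of `d` at the corners
and `ΔA, ΔB, ΔC` the changes of the angles. Each face term is nonpositive
(`euclideanAngle_vertexScaling`, `hyperbolicAngle_vertexScaling`), so equal curvatures make all of
them vanish. The equality case makes `d` constant (PL) or zero (PH) on the corners of each face.
Connectedness finishes the PL case; in the PH case it suffices that every vertex is a corner.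

The face inequality comes from interpolating angles, not lengths: angle triples form a convex set,
while the factors allowed by the triangle inequalities do not. By the sine law, `log sin A` is `log
a` plus a term common to the three corners, so the face term is `-2` times the pairing of `ΔA` with
`Δ log sin A`. That pairing is positive because `∑ cot A dA²` is positive definite on vectors of sum
zero (`angleDivergence_pos`). For hyperbolic triangles, `sinh (a/2)` in terms of the angles also
brings in `log cos` of `s`, `s - A`, `s - B`, `s - C`; the resulting pairing is a positive
combination of Euclidean ones (`three_mul_hyperbolicDivergence`). -/

/-! ### Convexity on triples of angles with sum π -/

open Real in
/-- The quadratic form of cotangents of the angles of a triangle is positive definite on the plane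
of vectors with vanishing sum. -/
theorem sum_sq_mul_cot_pos {A B C x y z : ℝ} (hA : 0 < A) (hB : 0 < B) (hC : 0 < C)
    (h : A + B + C = π) (hs : x + y + z = 0) (hne : ¬ (x = 0 ∧ y = 0 ∧ z = 0)) :
    0 < x ^ 2 * (cos A / sin A) + y ^ 2 * (cos B / sin B) + z ^ 2 * (cos C / sin C) := by
  have sA : 0 < sin A := sin_pos_of_pos_of_lt_pi hA (by linarith)
  have sB : 0 < sin B := sin_pos_of_pos_of_lt_pi hB (by linarith)
  have sC : 0 < sin C := sin_pos_of_pos_of_lt_pi hC (by linarith)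
  have hC' : C = π - (A + B) := by linarith
  have hsin : sin C = sin A * cos B + cos A * sin B := by rw [hC', sin_pi_sub, sin_add]
  have hcos : cos C = sin A * sin B - cos A * cos B := by
    rw [hC', cos_pi_sub, cos_add]; ring
  have hz : z = -(x + y) := by linarith
  -- With `z` eliminated, the coefficient of `x²` is `cot A + cot C = sin B / (sin A sin C)`, which
  -- lets the form be written as two squares.
  have key : x ^ 2 * (cos A / sin A) + y ^ 2 * (cos B / sin B) + z ^ 2 * (cos C / sin C) =
      ((x * (cos A / sin A) - y * (cos B / sin B)) ^ 2 + (x + y) ^ 2) * (sin A * sin B) / sin C := by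
    rw [hz, hcos]
    field_simp
    rw [hsin]
    ring
  rw [key]
  refine div_pos (mul_pos ?_ (mul_pos sA sB)) sC
  by_contra hcon
  have h1 : x + y = 0 := by nlinarith [sq_nonneg (x * (cos A / sin A) - y * (cos B / sin B))]
  have h2 : x * (cos A / sin A) - y * (cos B / sin B) = 0 := by
    nlinarith [sq_nonneg (x + y)]
  have hy : y = -x := by linarith
  have h3 : x * sin C = 0 := by
    rw [hy] at h2
    field_simp at h2
    rw [hsin]
    linear_combination h2
  have hx : x = 0 := by simpa [sC.ne'] using h3
  exact hne ⟨hx, by linarith, by linarith⟩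

/-- The symmetric divergence of the function `∑ log sin` between two triples of angles. -/
noncomputable def angleDivergence (A B C A' B' C' : ℝ) : ℝ :=
  (A' - A) * (Real.log (Real.sin A') - Real.log (Real.sin A)) +
    (B' - B) * (Real.log (Real.sin B') - Real.log (Real.sin B)) +
    (C' - C) * (Real.log (Real.sin C') - Real.log (Real.sin C))

-- The divergence is `g 1 - g 0` for `g` below, defined along the segment joining the two triples;
-- the derivative of `g` is the cotangent form at an intermediate triple, which still has positive
-- angles and sum π.
open Real in
theorem angleDivergence_pos {A B C A' B' C' : ℝ} (hA : 0 < A) (hB : 0 < B) (hC : 0 < C)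
    (h : A + B + C = π) (hA' : 0 < A') (hB' : 0 < B') (hC' : 0 < C') (h' : A' + B' + C' = π)
    (hne : ¬ (A' = A ∧ B' = B ∧ C' = C)) : 0 < angleDivergence A B C A' B' C' := by
  have conv : ∀ {X X' : ℝ}, 0 < X → 0 < X' → ∀ t ∈ Set.Icc (0 : ℝ) 1, 0 < X + t * (X' - X) := by
    intro X X' hX hX' t ht
    have e : X + t * (X' - X) = (1 - t) * X + t * X' := by ring
    rw [e]
    rcases ht.1.eq_or_lt with h0 | h0
    · simp [← h0, hX]
    · have := mul_pos h0 hX'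
      have := mul_nonneg (sub_nonneg.2 ht.2) hX.le
      linarith
  have der : ∀ X X' t : ℝ, 0 < sin (X + t * (X' - X)) →
      HasDerivAt (fun t => (X' - X) * log (sin (X + t * (X' - X))))
        ((X' - X) ^ 2 * (cos (X + t * (X' - X)) / sin (X + t * (X' - X)))) t := by
    intro X X' t hp
    have h1 : HasDerivAt (fun t => X + t * (X' - X)) (X' - X) t := by
      simpa using ((hasDerivAt_id t).mul_const (X' - X)).const_add X
    exact ((h1.sin.log hp.ne').const_mul (X' - X)).congr_deriv (by ring)
  have hsin : ∀ t ∈ Set.Icc (0 : ℝ) 1, 0 < sin (A + t * (A' - A)) ∧ 0 < sin (B + t * (B' - B)) ∧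
      0 < sin (C + t * (C' - C)) := by
    intro t ht
    have h1 := conv hA hA' t ht
    have h2 := conv hB hB' t ht
    have h3 := conv hC hC' t ht
    have h4 : A + t * (A' - A) + (B + t * (B' - B)) + (C + t * (C' - C)) = π := by
      linear_combination (1 - t) * h + t * h'
    exact ⟨sin_pos_of_pos_of_lt_pi h1 (by linarith), sin_pos_of_pos_of_lt_pi h2 (by linarith),
      sin_pos_of_pos_of_lt_pi h3 (by linarith)⟩
  set g : ℝ → ℝ := fun t => (A' - A) * log (sin (A + t * (A' - A))) +
    (B' - B) * log (sin (B + t * (B' - B))) + (C' - C) * log (sin (C + t * (C' - C))) with hg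
  have hgd : ∀ t ∈ Set.Icc (0 : ℝ) 1, HasDerivAt g _ t := fun t ht =>
    ((der A A' t (hsin t ht).1).add (der B B' t (hsin t ht).2.1)).add
      (der C C' t (hsin t ht).2.2)
  have hmono : StrictMonoOn g (Set.Icc 0 1) := by
    refine strictMonoOn_of_deriv_pos (convex_Icc 0 1)
      (fun t ht => (hgd t ht).continuousAt.continuousWithinAt) fun t ht => ?_
    rw [interior_Icc] at ht
    have ht' : t ∈ Set.Icc (0 : ℝ) 1 := Set.Ioo_subset_Icc_self ht
    rw [(hgd t ht').deriv]
    refine sum_sq_mul_cot_pos (conv hA hA' t ht') (conv hB hB' t ht') (conv hC hC' t ht')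
      (by linear_combination (1 - t) * h + t * h') (by linarith) ?_
    rintro ⟨h1, h2, h3⟩
    exact hne ⟨by linarith, by linarith, by linarith⟩
  have h01 := hmono (by simp) (by simp) (zero_lt_one' ℝ)
  simp only [hg, zero_mul, add_zero, one_mul, add_sub_cancel] at h01
  unfold angleDivergence
  linarith

open Real in
theorem angleDivergence_nonneg {A B C A' B' C' : ℝ} (hA : 0 < A) (hB : 0 < B) (hC : 0 < C)
    (h : A + B + C = π) (hA' : 0 < A') (hB' : 0 < B') (hC' : 0 < C') (h' : A' + B' + C' = π) :
    0 ≤ angleDivergence A B C A' B' C' := by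
  by_cases hne : A' = A ∧ B' = B ∧ C' = C
  · obtain ⟨rfl, rfl, rfl⟩ := hne
    simp [angleDivergence]
  · exact (angleDivergence_pos hA hB hC h hA' hB' hC' h' hne).le

/-! ### Trigonometric criteria for angle sums -/

open Real in
theorem cos_add_cos_add (x y z : ℝ) :
    cos x + cos (y + z) = 2 * cos ((x + y + z) / 2) * cos ((x + y + z) / 2 - x) := by
  rw [cos_add_cos, ← cos_neg ((x - (y + z)) / 2)]
  ring_nf

open Real in
/-- Three angles in `(0, π)` satisfying the non-strict spherical-excess inequalities have sum at
most `π`. -/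
theorem add_add_le_pi {x y z : ℝ} (hx : 0 < x) (hy : 0 < y) (hz : 0 < z) (hx' : x < π)
    (hy' : y < π) (hz' : z < π) (h1 : 0 ≤ cos x + cos (y + z)) (h2 : 0 ≤ cos y + cos (z + x)) :
    x + y + z ≤ π := by
  rw [cos_add_cos_add] at h1 h2
  by_contra! hlt
  rw [show y + z + x = x + y + z by ring] at h2
  have hc : cos ((x + y + z) / 2) < 0 :=
    cos_neg_of_pi_div_two_lt_of_lt (by linarith) (by linarith)
  have h3 : cos ((x + y + z) / 2 - x) ≤ 0 := by nlinarith
  have h4 : cos ((x + y + z) / 2 - y) ≤ 0 := by nlinarith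
  -- Two half-sum differences of at least `π / 2` add up to `z ≥ π`, a contradiction.
  have h5 : π / 2 ≤ (x + y + z) / 2 - x := by
    by_contra! hh
    exact absurd (cos_pos_of_mem_Ioo ⟨by linarith, hh⟩) h3.not_gt
  have h6 : π / 2 ≤ (x + y + z) / 2 - y := by
    by_contra! hh
    exact absurd (cos_pos_of_mem_Ioo ⟨by linarith, hh⟩) h4.not_gt
  linarith

open Real in
theorem arccos_mem_Ioo_of_sq_lt_one {t : ℝ} (h : t ^ 2 < 1) :
    0 < arccos t ∧ arccos t < π ∧ cos (arccos t) = t := by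
  obtain ⟨h1, h2⟩ := abs_lt.1 ((sq_lt_one_iff_abs_lt_one t).1 h)
  refine ⟨arccos_pos.2 h2, lt_of_le_of_ne (arccos_le_pi t) fun h => ?_, cos_arccos h1.le h2.le⟩
  exact absurd (arccos_eq_pi.1 h) (by linarith)

/-! ### Euclidean triangles -/

/-- Sixteen times the squared area of a Euclidean triangle. -/
def heron (a b c : ℝ) : ℝ := (a + b + c) * (b + c - a) * (c + a - b) * (a + b - c)

theorem heron_pos {a b c : ℝ} (ha : 0 < a) (hb : 0 < b) (hc : 0 < c) (h1 : a < b + c)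
    (h2 : b < c + a) (h3 : c < a + b) : 0 < heron a b c :=
  mul_pos (mul_pos (mul_pos (by linarith) (by linarith)) (by linarith)) (by linarith)

theorem heron_rotate (a b c : ℝ) : heron b c a = heron a b c := by unfold heron; ring

open Real in
theorem euclideanAngle_spec {a b c : ℝ} (ha : 0 < a) (hb : 0 < b) (hc : 0 < c) (h1 : a < b + c)
    (h2 : b < c + a) (h3 : c < a + b) :
    0 < euclideanAngle a b c ∧ euclideanAngle a b c < π ∧
      cos (euclideanAngle a b c) = (b ^ 2 + c ^ 2 - a ^ 2) / (2 * b * c) ∧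
      sin (euclideanAngle a b c) = √(heron a b c) / (2 * b * c) := by
  have hh := heron_pos ha hb hc h1 h2 h3
  have e : 1 - ((b ^ 2 + c ^ 2 - a ^ 2) / (2 * b * c)) ^ 2 = heron a b c / (2 * b * c) ^ 2 := by
    unfold heron; field_simp; ring
  have hp : 0 < heron a b c / (2 * b * c) ^ 2 := by positivity
  obtain ⟨g1, g2, g3⟩ := arccos_mem_Ioo_of_sq_lt_one
    (t := (b ^ 2 + c ^ 2 - a ^ 2) / (2 * b * c)) (by linarith)
  refine ⟨g1, g2, g3, ?_⟩
  rw [euclideanAngle, sin_arccos, e, sqrt_div hh.le, sqrt_sq (by positivity)]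

open Real in
theorem euclideanAngle_cos_add_cos {a b c : ℝ} (ha : 0 < a) (hb : 0 < b) (hc : 0 < c)
    (h1 : a < b + c) (h2 : b < c + a) (h3 : c < a + b) :
    cos (euclideanAngle a b c) + cos (euclideanAngle b c a + euclideanAngle c a b) = 0 := by
  obtain ⟨-, -, c1, -⟩ := euclideanAngle_spec ha hb hc h1 h2 h3
  obtain ⟨-, -, c2, s2⟩ := euclideanAngle_spec hb hc ha h2 h3 h1
  obtain ⟨-, -, c3, s3⟩ := euclideanAngle_spec hc ha hb h3 h1 h2
  have hs := mul_self_sqrt (heron_pos ha hb hc h1 h2 h3).le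
  rw [heron_rotate] at s2
  rw [heron_rotate, heron_rotate] at s3
  rw [cos_add, c1, c2, c3, s2, s3, div_mul_div_comm √_, hs, heron]
  field_simp
  ring

-- The identity `cos A + cos (B + C) = 0` factors through the half sum. `add_add_le_pi` excludes a
-- sum above π; below π both cosine factors would be positive.
open Real in
theorem euclideanAngle_add {a b c : ℝ} (ha : 0 < a) (hb : 0 < b) (hc : 0 < c)
    (h1 : a < b + c) (h2 : b < c + a) (h3 : c < a + b) :
    euclideanAngle a b c + euclideanAngle b c a + euclideanAngle c a b = π := by
  obtain ⟨p1, q1, -⟩ := euclideanAngle_spec ha hb hc h1 h2 h3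
  obtain ⟨p2, q2, -⟩ := euclideanAngle_spec hb hc ha h2 h3 h1
  obtain ⟨p3, q3, -⟩ := euclideanAngle_spec hc ha hb h3 h1 h2
  have e1 := euclideanAngle_cos_add_cos ha hb hc h1 h2 h3
  have hle := add_add_le_pi p1 p2 p3 q1 q2 q3 e1.ge
    (euclideanAngle_cos_add_cos hb hc ha h2 h3 h1).ge
  refine le_antisymm hle (not_lt.1 fun hlt => ?_)
  rw [cos_add_cos_add] at e1
  have := mul_pos (mul_pos two_pos (cos_pos_of_mem_Ioo
      (x := (euclideanAngle a b c + euclideanAngle b c a + euclideanAngle c a b) / 2)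
      ⟨by linarith, by linarith⟩)) (cos_pos_of_mem_Ioo
      (x := (euclideanAngle a b c + euclideanAngle b c a + euclideanAngle c a b) / 2 -
        euclideanAngle a b c) ⟨by linarith, by linarith⟩)
  linarith

-- The sine law: the second summand is symmetric in the sides, hence common to the three corners.
open Real in
theorem log_sin_euclideanAngle {a b c : ℝ} (ha : 0 < a) (hb : 0 < b) (hc : 0 < c) (h1 : a < b + c)
    (h2 : b < c + a) (h3 : c < a + b) :
    log (sin (euclideanAngle a b c)) = log a + log (√(heron a b c) / (2 * a * b * c)) := by
  have hp := sqrt_pos.2 (heron_pos ha hb hc h1 h2 h3)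
  rw [(euclideanAngle_spec ha hb hc h1 h2 h3).2.2.2, ← log_mul ha.ne' (by positivity)]
  congr 1
  field_simp

theorem euclideanAngle_scale {k : ℝ} (hk : 0 < k) (a b c : ℝ) :
    euclideanAngle (a * k) (b * k) (c * k) = euclideanAngle a b c := by
  unfold euclideanAngle
  rw [show ((b * k) ^ 2 + (c * k) ^ 2 - (a * k) ^ 2) = (b ^ 2 + c ^ 2 - a ^ 2) * k ^ 2 by ring,
    show 2 * (b * k) * (c * k) = 2 * b * c * k ^ 2 by ring,
    mul_div_mul_right _ _ (by positivity)]

open Real in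
/-- Vertex scaling of one Euclidean triangle: the angles are monotone in the logarithmic scale
factors, strictly so up to a common constant. -/
theorem euclideanAngle_vertexScaling {a b c a' b' c' x y z : ℝ}
    (ha : 0 < a) (hb : 0 < b) (hc : 0 < c) (h1 : a < b + c) (h2 : b < c + a) (h3 : c < a + b)
    (ha' : 0 < a') (hb' : 0 < b') (hc' : 0 < c') (h1' : a' < b' + c') (h2' : b' < c' + a')
    (h3' : c' < a' + b') (ea : a' = a * exp ((y + z) / 2)) (eb : b' = b * exp ((z + x) / 2))
    (ec : c' = c * exp ((x + y) / 2)) :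
    x * (euclideanAngle a' b' c' - euclideanAngle a b c) +
      y * (euclideanAngle b' c' a' - euclideanAngle b c a) +
      z * (euclideanAngle c' a' b' - euclideanAngle c a b) ≤ 0 ∧
    (x * (euclideanAngle a' b' c' - euclideanAngle a b c) +
      y * (euclideanAngle b' c' a' - euclideanAngle b c a) +
      z * (euclideanAngle c' a' b' - euclideanAngle c a b) = 0 → x = y ∧ y = z) := by
  have la : log a' = log a + (y + z) / 2 := by rw [ea, log_mul ha.ne' (exp_pos _).ne', log_exp]
  have lb : log b' = log b + (z + x) / 2 := by rw [eb, log_mul hb.ne' (exp_pos _).ne', log_exp]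
  have lc : log c' = log c + (x + y) / 2 := by rw [ec, log_mul hc.ne' (exp_pos _).ne', log_exp]
  have p1 := (euclideanAngle_spec ha hb hc h1 h2 h3).1
  have p2 := (euclideanAngle_spec hb hc ha h2 h3 h1).1
  have p3 := (euclideanAngle_spec hc ha hb h3 h1 h2).1
  have p1' := (euclideanAngle_spec ha' hb' hc' h1' h2' h3').1
  have p2' := (euclideanAngle_spec hb' hc' ha' h2' h3' h1').1
  have p3' := (euclideanAngle_spec hc' ha' hb' h3' h1' h2').1
  have s := euclideanAngle_add ha hb hc h1 h2 h3
  have s' := euclideanAngle_add ha' hb' hc' h1' h2' h3'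
  have l1 := log_sin_euclideanAngle ha hb hc h1 h2 h3
  have l2 := log_sin_euclideanAngle hb hc ha h2 h3 h1
  have l3 := log_sin_euclideanAngle hc ha hb h3 h1 h2
  have l1' := log_sin_euclideanAngle ha' hb' hc' h1' h2' h3'
  have l2' := log_sin_euclideanAngle hb' hc' ha' h2' h3' h1'
  have l3' := log_sin_euclideanAngle hc' ha' hb' h3' h1' h2'
  rw [heron_rotate, show 2 * b * c * a = 2 * a * b * c by ring] at l2
  rw [heron_rotate, heron_rotate, show 2 * c * a * b = 2 * a * b * c by ring] at l3
  rw [heron_rotate, show 2 * b' * c' * a' = 2 * a' * b' * c' by ring] at l2'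
  rw [heron_rotate, heron_rotate, show 2 * c' * a' * b' = 2 * a' * b' * c' by ring] at l3'
  generalize log (√(heron a b c) / (2 * a * b * c)) = k at l1 l2 l3
  generalize log (√(heron a' b' c') / (2 * a' * b' * c')) = k' at l1' l2' l3'
  generalize euclideanAngle a b c = A at *
  generalize euclideanAngle b c a = B at *
  generalize euclideanAngle c a b = C at *
  generalize euclideanAngle a' b' c' = A' at *
  generalize euclideanAngle b' c' a' = B' at *
  generalize euclideanAngle c' a' b' = C' at *
  -- `log sin A' - log sin A` is `-x/2` plus a quantity common to the three corners, which drops out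
  -- because the angle changes sum to zero.
  have key : x * (A' - A) + y * (B' - B) + z * (C' - C) = -2 * angleDivergence A B C A' B' C' := by
    unfold angleDivergence
    rw [l1, l2, l3, l1', l2', l3', la, lb, lc]
    linear_combination (x + y + z + 2 * (k' - k)) * (s' - s)
  rw [key]
  refine ⟨by linarith [angleDivergence_nonneg p1 p2 p3 s p1' p2' p3' s'], fun h0 => ?_⟩
  by_cases hne : A' = A ∧ B' = B ∧ C' = C
  · obtain ⟨rfl, rfl, rfl⟩ := hne
    constructor <;> linarith
  · linarith [angleDivergence_pos p1 p2 p3 s p1' p2' p3' s' hne]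

/-! ### Hyperbolic triangles -/

/-- The divergence governing hyperbolic triangles: a sum over the six angles `A`, `B`, `C`,
`π/2 - s`, `π/2 - (s - A)`, …, where `s` is half the angle sum. -/
noncomputable def hyperbolicDivergence (A B C A' B' C' : ℝ) : ℝ :=
  angleDivergence A B C A' B' C' -
    ((A' + B' + C') / 2 - (A + B + C) / 2) *
      (Real.log (Real.cos ((A' + B' + C') / 2)) - Real.log (Real.cos ((A + B + C) / 2))) -
    (((A' + B' + C') / 2 - A') - ((A + B + C) / 2 - A)) *
      (Real.log (Real.cos ((A' + B' + C') / 2 - A')) - Real.log (Real.cos ((A + B + C) / 2 - A))) -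
    (((A' + B' + C') / 2 - B') - ((A + B + C) / 2 - B)) *
      (Real.log (Real.cos ((A' + B' + C') / 2 - B')) - Real.log (Real.cos ((A + B + C) / 2 - B))) -
    (((A' + B' + C') / 2 - C') - ((A + B + C) / 2 - C)) *
      (Real.log (Real.cos ((A' + B' + C') / 2 - C')) - Real.log (Real.cos ((A + B + C) / 2 - C)))

open Real in
/-- The hyperbolic divergence is an average of divergences of triples of angles with sum `π`. -/
theorem three_mul_hyperbolicDivergence (A B C A' B' C' : ℝ) :
    let s := (A + B + C) / 2
    let s' := (A' + B' + C') / 2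
    3 * hyperbolicDivergence A B C A' B' C' =
      2 * (angleDivergence A (π / 2 - (s - B)) (π / 2 - (s - C))
          A' (π / 2 - (s' - B')) (π / 2 - (s' - C')) +
        angleDivergence B (π / 2 - (s - C)) (π / 2 - (s - A))
          B' (π / 2 - (s' - C')) (π / 2 - (s' - A')) +
        angleDivergence C (π / 2 - (s - A)) (π / 2 - (s - B))
          C' (π / 2 - (s' - A')) (π / 2 - (s' - B'))) +
      (angleDivergence (π / 2 - s) A ((s - A) + π / 2) (π / 2 - s') A' ((s' - A') + π / 2) +
        angleDivergence (π / 2 - s) B ((s - B) + π / 2) (π / 2 - s') B' ((s' - B') + π / 2) +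
        angleDivergence (π / 2 - s) C ((s - C) + π / 2) (π / 2 - s') C' ((s' - C') + π / 2)) := by
  intro s s'
  -- Each `s - A` term occurs four times in the first group and once, with opposite sign through the
  -- supplementary angle, in the second: `4 - 1 = 3`.
  simp only [hyperbolicDivergence, angleDivergence, sin_pi_div_two_sub, sin_add_pi_div_two, s, s']
  ring

open Real in
theorem hyperbolicDivergence_pos {A B C A' B' C' : ℝ} (hA : 0 < A) (hB : 0 < B) (hC : 0 < C)
    (h : A + B + C < π) (hA' : 0 < A') (hB' : 0 < B') (hC' : 0 < C') (h' : A' + B' + C' < π)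
    (hne : ¬ (A' = A ∧ B' = B ∧ C' = C)) : 0 < hyperbolicDivergence A B C A' B' C' := by
  have key := three_mul_hyperbolicDivergence A B C A' B' C'
  dsimp only at key
  have aux : ∀ {X Y Z X' Y' Z' : ℝ}, 0 < X → 0 < Y → 0 < Z → X + Y + Z < π → 0 < X' → 0 < Y' →
      0 < Z' → X' + Y' + Z' < π →
      0 ≤ angleDivergence X (π / 2 - ((X + Y + Z) / 2 - Y)) (π / 2 - ((X + Y + Z) / 2 - Z))
        X' (π / 2 - ((X' + Y' + Z') / 2 - Y')) (π / 2 - ((X' + Y' + Z') / 2 - Z')) ∧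
      0 ≤ angleDivergence (π / 2 - (X + Y + Z) / 2) X (((X + Y + Z) / 2 - X) + π / 2)
        (π / 2 - (X' + Y' + Z') / 2) X' (((X' + Y' + Z') / 2 - X') + π / 2) ∧
      (X' ≠ X → 0 < angleDivergence X (π / 2 - ((X + Y + Z) / 2 - Y))
        (π / 2 - ((X + Y + Z) / 2 - Z)) X' (π / 2 - ((X' + Y' + Z') / 2 - Y'))
        (π / 2 - ((X' + Y' + Z') / 2 - Z'))) := by
    intro X Y Z X' Y' Z' hX hY hZ hs hX' hY' hZ' hs'
    refine ⟨?_, ?_, fun hn => ?_⟩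
    · apply angleDivergence_nonneg <;> linarith
    · apply angleDivergence_nonneg <;> linarith
    · apply angleDivergence_pos <;> first | linarith | exact fun hh => hn hh.1
  obtain ⟨a1, a2, a3⟩ := aux hA hB hC h hA' hB' hC' h'
  obtain ⟨b1, b2, b3⟩ := aux hB hC hA (by linarith) hB' hC' hA' (by linarith)
  obtain ⟨c1, c2, c3⟩ := aux hC hA hB (by linarith) hC' hA' hB' (by linarith)
  rw [show B + C + A = A + B + C by ring, show B' + C' + A' = A' + B' + C' by ring] at b1 b2 b3
  rw [show C + A + B = A + B + C by ring, show C' + A' + B' = A' + B' + C' by ring] at c1 c2 c3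
  by_cases h1 : A' = A
  · by_cases h2 : B' = B
    · linarith [c3 fun h3 => hne ⟨h1, h2, h3⟩]
    · linarith [b3 h2]
  · linarith [a3 h1]

/-- The Gram determinant of a hyperbolic triangle. -/
noncomputable def hyperbolicGram (a b c : ℝ) : ℝ :=
  1 + 2 * Real.cosh a * Real.cosh b * Real.cosh c - Real.cosh a ^ 2 - Real.cosh b ^ 2 -
    Real.cosh c ^ 2

theorem hyperbolicGram_rotate (a b c : ℝ) : hyperbolicGram b c a = hyperbolicGram a b c := by
  unfold hyperbolicGram; ring

open Real in
theorem hyperbolicGram_pos {a b c : ℝ} (ha : 0 < a) (hb : 0 < b) (hc : 0 < c) (h1 : a < b + c)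
    (h2 : b < c + a) (h3 : c < a + b) : 0 < hyperbolicGram a b c := by
  -- The analogue of Heron's factorization; each factor is positive by the triangle inequalities.
  have e : hyperbolicGram a b c = (cosh (b + c) - cosh a) * (cosh a - cosh (b - c)) := by
    rw [cosh_add, cosh_sub, hyperbolicGram]
    linear_combination sinh b ^ 2 * cosh_sq c + (cosh c ^ 2 - 1) * cosh_sq b
  rw [e]
  refine mul_pos (sub_pos.2 (cosh_lt_cosh.2 ?_)) (sub_pos.2 (cosh_lt_cosh.2 ?_))
  · rwa [abs_of_pos ha, abs_of_pos (by linarith)]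
  · rw [abs_of_pos ha, abs_lt]
    constructor <;> linarith

open Real in
theorem hyperbolicAngle_spec {a b c : ℝ} (ha : 0 < a) (hb : 0 < b) (hc : 0 < c) (h1 : a < b + c)
    (h2 : b < c + a) (h3 : c < a + b) :
    0 < hyperbolicAngle a b c ∧ hyperbolicAngle a b c < π ∧
      cos (hyperbolicAngle a b c) = (cosh b * cosh c - cosh a) / (sinh b * sinh c) ∧
      sin (hyperbolicAngle a b c) = √(hyperbolicGram a b c) / (sinh b * sinh c) := by
  have hh := hyperbolicGram_pos ha hb hc h1 h2 h3
  have sb := sinh_pos_iff.2 hb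
  have sc := sinh_pos_iff.2 hc
  have e : 1 - ((cosh b * cosh c - cosh a) / (sinh b * sinh c)) ^ 2 =
      hyperbolicGram a b c / (sinh b * sinh c) ^ 2 := by
    unfold hyperbolicGram
    field_simp
    linear_combination -(sinh b ^ 2) * cosh_sq c + (1 - cosh c ^ 2) * cosh_sq b
  have hp : 0 < hyperbolicGram a b c / (sinh b * sinh c) ^ 2 := by positivity
  obtain ⟨g1, g2, g3⟩ := arccos_mem_Ioo_of_sq_lt_one
    (t := (cosh b * cosh c - cosh a) / (sinh b * sinh c)) (by linarith)
  refine ⟨g1, g2, g3, ?_⟩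
  rw [hyperbolicAngle, sin_arccos, e, sqrt_div hh.le, sqrt_sq (by positivity)]

-- The dual law of cosines, with `cosh a - 1 = 2 sinh² (a/2)`. It yields both the angle deficit and
-- the side lengths in terms of angles.
open Real in
theorem hyperbolicAngle_cos_add_cos {a b c : ℝ} (ha : 0 < a) (hb : 0 < b) (hc : 0 < c)
    (h1 : a < b + c) (h2 : b < c + a) (h3 : c < a + b) :
    cos (hyperbolicAngle a b c) + cos (hyperbolicAngle b c a + hyperbolicAngle c a b) =
      2 * sinh (a / 2) ^ 2 * (sin (hyperbolicAngle b c a) * sin (hyperbolicAngle c a b)) := by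
  obtain ⟨-, -, c1, -⟩ := hyperbolicAngle_spec ha hb hc h1 h2 h3
  obtain ⟨-, -, c2, s2⟩ := hyperbolicAngle_spec hb hc ha h2 h3 h1
  obtain ⟨-, -, c3, s3⟩ := hyperbolicAngle_spec hc ha hb h3 h1 h2
  have hs := mul_self_sqrt (hyperbolicGram_pos ha hb hc h1 h2 h3).le
  have hsa := (sinh_pos_iff.2 ha).ne'
  have hsb := (sinh_pos_iff.2 hb).ne'
  have hsc := (sinh_pos_iff.2 hc).ne'
  rw [hyperbolicGram_rotate] at s2
  rw [hyperbolicGram_rotate, hyperbolicGram_rotate] at s3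
  have half : 2 * sinh (a / 2) ^ 2 = cosh a - 1 := by
    have e := cosh_two_mul (a / 2)
    rw [mul_div_cancel₀ a two_ne_zero, cosh_sq] at e
    linarith
  rw [cos_add, c1, c2, c3, s2, s3, half, div_mul_div_comm √_, hs, hyperbolicGram]
  field_simp
  linear_combination (cosh a - cosh b * cosh c) * cosh_sq a

open Real in
theorem hyperbolicAngle_add_lt {a b c : ℝ} (ha : 0 < a) (hb : 0 < b) (hc : 0 < c)
    (h1 : a < b + c) (h2 : b < c + a) (h3 : c < a + b) :
    hyperbolicAngle a b c + hyperbolicAngle b c a + hyperbolicAngle c a b < π := by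
  obtain ⟨p1, q1, -⟩ := hyperbolicAngle_spec ha hb hc h1 h2 h3
  obtain ⟨p2, q2, -⟩ := hyperbolicAngle_spec hb hc ha h2 h3 h1
  obtain ⟨p3, q3, -⟩ := hyperbolicAngle_spec hc ha hb h3 h1 h2
  have s1 := sin_pos_of_pos_of_lt_pi p1 q1
  have s2 := sin_pos_of_pos_of_lt_pi p2 q2
  have s3 := sin_pos_of_pos_of_lt_pi p3 q3
  have ta := sinh_pos_iff.2 (half_pos ha)
  have tb := sinh_pos_iff.2 (half_pos hb)
  have e1 : 0 < cos (hyperbolicAngle a b c) +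
      cos (hyperbolicAngle b c a + hyperbolicAngle c a b) := by
    rw [hyperbolicAngle_cos_add_cos ha hb hc h1 h2 h3]; positivity
  have e2 : 0 < cos (hyperbolicAngle b c a) +
      cos (hyperbolicAngle c a b + hyperbolicAngle a b c) := by
    rw [hyperbolicAngle_cos_add_cos hb hc ha h2 h3 h1]; positivity
  refine lt_of_le_of_ne (add_add_le_pi p1 p2 p3 q1 q2 q3 e1.le e2.le) fun hs => ?_
  rw [cos_add_cos_add, hs, cos_pi_div_two] at e1
  simp at e1

open Real in
/-- The length of a side of a hyperbolic triangle in terms of its angles. -/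
theorem two_mul_log_sinh_half {a b c : ℝ} (ha : 0 < a) (hb : 0 < b) (hc : 0 < c)
    (h1 : a < b + c) (h2 : b < c + a) (h3 : c < a + b) :
    2 * log (sinh (a / 2)) =
      log (cos ((hyperbolicAngle a b c + hyperbolicAngle b c a + hyperbolicAngle c a b) / 2)) +
      log (cos ((hyperbolicAngle a b c + hyperbolicAngle b c a + hyperbolicAngle c a b) / 2 -
        hyperbolicAngle a b c)) -
      log (sin (hyperbolicAngle b c a)) - log (sin (hyperbolicAngle c a b)) := by
  have e := hyperbolicAngle_cos_add_cos ha hb hc h1 h2 h3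
  have hs := hyperbolicAngle_add_lt ha hb hc h1 h2 h3
  obtain ⟨p1, q1, -⟩ := hyperbolicAngle_spec ha hb hc h1 h2 h3
  obtain ⟨p2, q2, -⟩ := hyperbolicAngle_spec hb hc ha h2 h3 h1
  obtain ⟨p3, q3, -⟩ := hyperbolicAngle_spec hc ha hb h3 h1 h2
  have ta := (sinh_pos_iff.2 (half_pos ha)).ne'
  have s2 := (sin_pos_of_pos_of_lt_pi p2 q2).ne'
  have s3 := (sin_pos_of_pos_of_lt_pi p3 q3).ne'
  rw [cos_add_cos_add] at e
  have k1 := (cos_pos_of_mem_Ioo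
    (x := (hyperbolicAngle a b c + hyperbolicAngle b c a + hyperbolicAngle c a b) / 2)
    ⟨by linarith, by linarith⟩).ne'
  have k2 := (cos_pos_of_mem_Ioo
    (x := (hyperbolicAngle a b c + hyperbolicAngle b c a + hyperbolicAngle c a b) / 2 -
      hyperbolicAngle a b c) ⟨by linarith, by linarith⟩).ne'
  rw [mul_assoc, mul_assoc] at e
  have e' := congrArg log (mul_left_cancel₀ two_ne_zero e)
  rw [log_mul k1 k2, log_mul (pow_ne_zero 2 ta) (mul_ne_zero s2 s3), log_mul s2 s3, log_pow] at e'
  push_cast at e'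
  linarith

open Real in
/-- Vertex scaling of one hyperbolic triangle: the angles are strictly monotone in the logarithmic
scale factors. -/
theorem hyperbolicAngle_vertexScaling {a b c a' b' c' x y z : ℝ}
    (ha : 0 < a) (hb : 0 < b) (hc : 0 < c) (h1 : a < b + c) (h2 : b < c + a) (h3 : c < a + b)
    (ha' : 0 < a') (hb' : 0 < b') (hc' : 0 < c') (h1' : a' < b' + c') (h2' : b' < c' + a')
    (h3' : c' < a' + b') (ea : sinh (a' / 2) = sinh (a / 2) * exp ((y + z) / 2))
    (eb : sinh (b' / 2) = sinh (b / 2) * exp ((z + x) / 2))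
    (ec : sinh (c' / 2) = sinh (c / 2) * exp ((x + y) / 2)) :
    x * (hyperbolicAngle a' b' c' - hyperbolicAngle a b c) +
      y * (hyperbolicAngle b' c' a' - hyperbolicAngle b c a) +
      z * (hyperbolicAngle c' a' b' - hyperbolicAngle c a b) ≤ 0 ∧
    (x * (hyperbolicAngle a' b' c' - hyperbolicAngle a b c) +
      y * (hyperbolicAngle b' c' a' - hyperbolicAngle b c a) +
      z * (hyperbolicAngle c' a' b' - hyperbolicAngle c a b) = 0 → x = 0 ∧ y = 0 ∧ z = 0) := by
  have loge : ∀ {r r' q : ℝ}, 0 < r → sinh (r' / 2) = sinh (r / 2) * exp (q / 2) →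
      2 * log (sinh (r' / 2)) = 2 * log (sinh (r / 2)) + q := by
    intro r r' q hr h
    rw [h, log_mul (sinh_pos_iff.2 (half_pos hr)).ne' (exp_pos _).ne', log_exp]
    ring
  have la := loge ha ea
  have lb := loge hb eb
  have lc := loge hc ec
  have p1 := (hyperbolicAngle_spec ha hb hc h1 h2 h3).1
  have p2 := (hyperbolicAngle_spec hb hc ha h2 h3 h1).1
  have p3 := (hyperbolicAngle_spec hc ha hb h3 h1 h2).1
  have p1' := (hyperbolicAngle_spec ha' hb' hc' h1' h2' h3').1
  have p2' := (hyperbolicAngle_spec hb' hc' ha' h2' h3' h1').1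
  have p3' := (hyperbolicAngle_spec hc' ha' hb' h3' h1' h2').1
  have s := hyperbolicAngle_add_lt ha hb hc h1 h2 h3
  have s' := hyperbolicAngle_add_lt ha' hb' hc' h1' h2' h3'
  rw [two_mul_log_sinh_half ha hb hc h1 h2 h3, two_mul_log_sinh_half ha' hb' hc' h1' h2' h3'] at la
  rw [two_mul_log_sinh_half hb hc ha h2 h3 h1, two_mul_log_sinh_half hb' hc' ha' h2' h3' h1'] at lb
  rw [two_mul_log_sinh_half hc ha hb h3 h1 h2, two_mul_log_sinh_half hc' ha' hb' h3' h1' h2'] at lc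
  generalize hyperbolicAngle a b c = A at *
  generalize hyperbolicAngle b c a = B at *
  generalize hyperbolicAngle c a b = C at *
  generalize hyperbolicAngle a' b' c' = A' at *
  generalize hyperbolicAngle b' c' a' = B' at *
  generalize hyperbolicAngle c' a' b' = C' at *
  rw [show B + C + A = A + B + C by ring, show B' + C' + A' = A' + B' + C' by ring] at lb
  rw [show C + A + B = A + B + C by ring, show C' + A' + B' = A' + B' + C' by ring] at lc
  -- Equal angles force `y + z`, `z + x` and `x + y` to vanish.
  by_cases hne : A' = A ∧ B' = B ∧ C' = C
  · obtain ⟨rfl, rfl, rfl⟩ := hne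
    refine ⟨by simp, fun _ => ⟨?_, ?_, ?_⟩⟩ <;> linarith
  -- Since `x = ((z + x) + (x + y) - (y + z)) / 2`, the coefficient of `la` is minus the change of
  -- `s - A`.
  have key : x * (A' - A) + y * (B' - B) + z * (C' - C) =
      -hyperbolicDivergence A B C A' B' C' := by
    unfold hyperbolicDivergence angleDivergence
    linear_combination ((A' - A) - (B' - B) - (C' - C)) / 2 * la +
      ((B' - B) - (A' - A) - (C' - C)) / 2 * lb + ((C' - C) - (B' - B) - (A' - A)) / 2 * lc
  have := hyperbolicDivergence_pos p1 p2 p3 s p1' p2' p3' s' hne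
  rw [key]
  exact ⟨by linarith, fun h0 => by linarith⟩

/-! ### Cells and connectedness of the triangulated surface -/

theorem stdSimplex.exists_map_succAbove_eq {n : ℕ} (x : stdSimplex ℝ (Fin (n + 2)))
    (i : Fin (n + 2)) (hi : x i = 0) (σ : Equiv.Perm (Fin (n + 1))) :
    ∃ y : stdSimplex ℝ (Fin (n + 1)), stdSimplex.map (fun a => i.succAbove (σ a)) y = x := by
  have hs : ∑ a, x (i.succAbove (σ a)) = 1 := by
    rw [Equiv.sum_comp σ fun a => x (i.succAbove a)]
    have := x.2.2
    rw [Fin.sum_univ_succAbove _ i] at this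
    change x i + _ = 1 at this
    rwa [hi, zero_add] at this
  refine ⟨⟨fun a => x (i.succAbove (σ a)), fun a => x.2.1 _, hs⟩, ?_⟩
  refine stdSimplex.ext (funext fun j => ?_)
  rw [stdSimplex.map_coe, FunOnFinite.linearMap_apply_apply]
  rcases Fin.eq_self_or_eq_succAbove i j with rfl | ⟨k, rfl⟩
  · rw [hi]
    exact Finset.sum_eq_zero fun a ha => absurd (Finset.mem_filter.1 ha).2 (Fin.succAbove_ne _ _)
  · rw [Finset.sum_eq_single_of_mem (σ.symm k) (by simp)]
    · exact congrArg x (by simp)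
    · intro b hb hbk
      refine absurd ?_ hbk
      rw [Equiv.eq_symm_apply]
      exact Fin.succAbove_right_injective (Finset.mem_filter.1 hb).2

theorem stdSimplex.eq_vertex_of_apply_eq_zero (x : stdSimplex ℝ (Fin 2)) (i : Fin 2)
    (hi : x i = 0) : ∃ a, x = stdSimplex.vertex a := by
  obtain ⟨y, hy⟩ := stdSimplex.exists_map_succAbove_eq x i hi 1
  refine ⟨i.succAbove 0, ?_⟩
  have : y = stdSimplex.vertex 0 := Subsingleton.elim _ _
  rw [← hy, this, stdSimplex.map_vertex]
  rfl

namespace SurfaceTriangulation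

section Topology

variable {V E F M : Type*} [TopologicalSpace M] (T : SurfaceTriangulation V E F M)

theorem vertexPoint_injective : Function.Injective T.vertexPoint := fun v w h =>
  Sum.inl_injective (T.cells_bijective.1 (a₁ := Sum.inl v) (a₂ := Sum.inl w) h)

theorem corner_succAbove (f : F) (i : Fin 3) : ∃ σ : Equiv.Perm (Fin 2),
    ∀ a, T.corner f (i.succAbove (σ a)) = T.ends (T.side f i) a := by
  obtain ⟨σ, hσ⟩ := T.faceMap_side f i
  refine ⟨σ, fun a => T.vertexPoint_injective ?_⟩
  have := hσ (stdSimplex.vertex a)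
  rwa [stdSimplex.map_vertex, T.faceMap_vertex, T.edgeMap_vertex] at this

/-- The end points of the side opposite to corner `i` are the two other corners. -/
theorem add_ends_side (f : F) (i : Fin 3) (u : V → ℝ) :
    u (T.ends (T.side f i) 0) + u (T.ends (T.side f i) 1) =
      u (T.corner f (i + 1)) + u (T.corner f (i + 2)) := by
  obtain ⟨σ, hσ⟩ := T.corner_succAbove f i
  rw [← hσ 0, ← hσ 1]
  have := Equiv.sum_comp σ fun a => u (T.corner f (i.succAbove a))
  rw [Fin.sum_univ_two, Fin.sum_univ_two] at this
  rw [this]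
  -- Only for `i = 1` does the order of `succAbove` differ from the cyclic order.
  fin_cases i
  · rfl
  · exact add_comm _ _
  · rfl

/-- A point of a closed face lies in an open cell one of whose vertices is a corner of the face. -/
theorem exists_cell_eq_faceMap (f : F) (x : stdSimplex ℝ (Fin 3)) :
    ∃ c : V ⊕ (E × OpenSimplex 1 ⊕ F × OpenSimplex 2),
      Sum.elim T.vertexPoint (Sum.elim (fun p : E × OpenSimplex 1 => T.edgeMap p.1 p.2.1)
        (fun p : F × OpenSimplex 2 => T.faceMap p.1 p.2.1)) c = T.faceMap f x ∧
      Sum.elim id (Sum.elim (fun p => T.ends p.1 0) (fun p => T.corner p.1 0)) c ∈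
        Set.range (T.corner f) := by
  by_cases hx : ∀ i, 0 < x i
  · exact ⟨Sum.inr (Sum.inr (f, ⟨x, hx⟩)), rfl, 0, rfl⟩
  push Not at hx
  obtain ⟨i, hi⟩ := hx
  obtain ⟨σ, hσ⟩ := T.faceMap_side f i
  obtain ⟨y, rfl⟩ := stdSimplex.exists_map_succAbove_eq x i (le_antisymm hi (x.2.1 i)) σ
  obtain ⟨τ, hτ⟩ := T.corner_succAbove f i
  by_cases hy : ∀ a, 0 < y a
  · exact ⟨Sum.inr (Sum.inl (T.side f i, ⟨y, hy⟩)), (hσ y).symm, _, hτ 0⟩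
  push Not at hy
  obtain ⟨a, ha⟩ := hy
  obtain ⟨b, rfl⟩ := stdSimplex.eq_vertex_of_apply_eq_zero y a (le_antisymm ha (y.2.1 a))
  exact ⟨Sum.inl (T.ends (T.side f i) b), by rw [hσ, T.edgeMap_vertex]; rfl, _, hτ b⟩

theorem exists_corner_eq (v : V) : ∃ f i, T.corner f i = v := by
  obtain ⟨f, x, hx⟩ := T.faces_cover (T.vertexPoint v)
  obtain ⟨c, hc, i, hi⟩ := T.exists_cell_eq_faceMap f x
  have : c = Sum.inl v := T.cells_bijective.1 (hc.trans hx)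
  subst this
  exact ⟨f, i, hi⟩

/-- Both points lie in the same open cell, and the vertex that `exists_cell_eq_faceMap` attaches to
a cell does not depend on the face. -/
theorem exists_corner_eq_corner {f g : F} {x y : stdSimplex ℝ (Fin 3)}
    (h : T.faceMap f x = T.faceMap g y) : ∃ i j, T.corner f i = T.corner g j := by
  obtain ⟨c, hc, i, hi⟩ := T.exists_cell_eq_faceMap f x
  obtain ⟨c', hc', j, hj⟩ := T.exists_cell_eq_faceMap g y
  have : c = c' := T.cells_bijective.1 (hc.trans (h.trans hc'.symm))
  subst this
  exact ⟨i, j, hi.trans hj.symm⟩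

/-- A function on the vertices which is constant on the corners of each face is constant. -/
theorem eq_of_forall_corner_eq [Finite F] [T2Space M] [ConnectedSpace M] {α : Type*} (d : V → α)
    (hd : ∀ f i j, d (T.corner f i) = d (T.corner f j)) (v w : V) : d v = d w := by
  by_contra hne
  have closed : ∀ P : F → Prop, IsClosed (⋃ f ∈ {f | P f}, Set.range (T.faceMap f)) := fun P =>
    (Set.toFinite _).isClosed_biUnion fun f _ =>
      (isCompact_range (T.faceMap f).continuous).isClosed
  obtain ⟨f, i, rfl⟩ := T.exists_corner_eq v
  obtain ⟨g, j, rfl⟩ := T.exists_corner_eq w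
  -- The faces carrying the value of `d` at `v` and the remaining faces cover `M` by two nonempty
  -- closed sets, which must meet; a face of each kind then share a corner.
  obtain ⟨p, -, hp, hq⟩ := isPreconnected_closed_iff.1 isPreconnected_univ _ _
    (closed fun k => d (T.corner k 0) = d (T.corner f i))
    (closed fun k => d (T.corner k 0) ≠ d (T.corner f i))
    (fun p _ => by
      obtain ⟨k, x, hx⟩ := T.faces_cover p
      by_cases hk : d (T.corner k 0) = d (T.corner f i)
      · exact Or.inl (Set.mem_biUnion hk ⟨x, hx⟩)
      · exact Or.inr (Set.mem_biUnion hk ⟨x, hx⟩))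
    ⟨T.vertexPoint (T.corner f i), trivial,
      Set.mem_biUnion (x := f) (hd f 0 i) ⟨_, T.faceMap_vertex f i⟩⟩
    ⟨T.vertexPoint (T.corner g j), trivial,
      Set.mem_biUnion (x := g) (fun h => hne (h.symm.trans (hd g 0 j)))
        ⟨_, T.faceMap_vertex g j⟩⟩
  simp only [Set.mem_iUnion] at hp hq
  obtain ⟨k, hk, x, hx⟩ := hp
  obtain ⟨m, hm, y, hy⟩ := hq
  obtain ⟨a, b, hab⟩ := T.exists_corner_eq_corner (hx.trans hy.symm)
  exact hm (by rw [hd m 0 b, ← hab, hd k a 0, hk])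

end Topology

/-! ### Summation over faces -/

section Curvature

variable {V E F M : Type*} [Fintype V] [Fintype F] [TopologicalSpace M]
  (T : SurfaceTriangulation V E F M)

/-- Each corner contributes to one vertex only. The `2π` cancels, and the minus sign in the
curvature exchanges `l` and `l'`. -/
theorem sum_mul_curvature_sub (angle : ℝ → ℝ → ℝ → ℝ) (l l' : E → ℝ) (d : V → ℝ) :
    ∑ v, d v * (T.curvature angle l v - T.curvature angle l' v) =
      ∑ f, ∑ i, d (T.corner f i) *
        (angle (l' (T.side f i)) (l' (T.side f (i + 1))) (l' (T.side f (i + 2))) -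
          angle (l (T.side f i)) (l (T.side f (i + 1))) (l (T.side f (i + 2)))) := by
  classical
  simp only [curvature, sub_sub_sub_cancel_left, ← Finset.sum_sub_distrib, Finset.mul_sum]
  rw [Finset.sum_comm]
  refine Finset.sum_congr rfl fun f _ => ?_
  rw [Finset.sum_comm]
  refine Finset.sum_congr rfl fun i _ => ?_
  rw [Finset.sum_eq_single (T.corner f i)]
  · simp
  · intro v _ hv
    simp [hv.symm]
  · simp

/-- If on each face the angles are monotone in the scale factors, then metrics with the same
curvature are in the equality case on each face. -/
theorem sum_corner_eq_zero {angle : ℝ → ℝ → ℝ → ℝ} {l l' : E → ℝ} {d : V → ℝ}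
    (h : ∀ f, ∑ i, d (T.corner f i) *
        (angle (l' (T.side f i)) (l' (T.side f (i + 1))) (l' (T.side f (i + 2))) -
          angle (l (T.side f i)) (l (T.side f (i + 1))) (l (T.side f (i + 2)))) ≤ 0)
    (hK : T.curvature angle l' = T.curvature angle l) (f : F) :
    ∑ i, d (T.corner f i) *
        (angle (l' (T.side f i)) (l' (T.side f (i + 1))) (l' (T.side f (i + 2))) -
          angle (l (T.side f i)) (l (T.side f (i + 1))) (l (T.side f (i + 2)))) = 0 := by
  refine (Finset.sum_eq_zero_iff_of_nonpos fun f _ => h f).1 ?_ f (Finset.mem_univ f)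
  rw [← sum_mul_curvature_sub, hK]
  simp

end Curvature

/-! ### Rigidity from the one-triangle inequalities -/

section Rigidity

variable {V E F M : Type*} [TopologicalSpace M] {T : SurfaceTriangulation V E F M}

theorem IsDiscreteMetric.triangle {l : E → ℝ} (h : T.IsDiscreteMetric l) (f : F) :
    l (T.side f 0) < l (T.side f 1) + l (T.side f 2) ∧
      l (T.side f 1) < l (T.side f 2) + l (T.side f 0) ∧
      l (T.side f 2) < l (T.side f 0) + l (T.side f 1) :=
  ⟨h.2 f 0, h.2 f 1, h.2 f 2⟩

theorem exp_ends_side (f : F) (i : Fin 3) (u u' : V → ℝ) :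
    Real.exp ((u' (T.ends (T.side f i) 0) + u' (T.ends (T.side f i) 1)) / 2) =
      Real.exp ((u (T.ends (T.side f i) 0) + u (T.ends (T.side f i) 1)) / 2) *
        Real.exp (((u' - u) (T.corner f (i + 1)) + (u' - u) (T.corner f (i + 2))) / 2) := by
  rw [← T.add_ends_side f i (u' - u), ← Real.exp_add]
  simp only [Pi.sub_apply]
  ring_nf

theorem IsEuclideanVertexScaling.sub_corner_eq [Fintype V] [Fintype F] {l₀ l l' : E → ℝ}
    {u u' : V → ℝ} (h : T.IsEuclideanVertexScaling l₀ u l)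
    (h' : T.IsEuclideanVertexScaling l₀ u' l') (hK : T.curvaturePL l' = T.curvaturePL l)
    (f : F) (i j : Fin 3) : (u' - u) (T.corner f i) = (u' - u) (T.corner f j) := by
  obtain ⟨-, m, e⟩ := h
  obtain ⟨-, m', e'⟩ := h'
  have rel : ∀ f i, l' (T.side f i) = l (T.side f i) *
      Real.exp (((u' - u) (T.corner f (i + 1)) + (u' - u) (T.corner f (i + 2))) / 2) := by
    intro f i
    rw [e', e, exp_ends_side f i u u', mul_assoc]
  have face : ∀ f, _ := fun f => euclideanAngle_vertexScaling (m.1 _) (m.1 _) (m.1 _)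
    (m.triangle f).1 (m.triangle f).2.1 (m.triangle f).2.2 (m'.1 _) (m'.1 _) (m'.1 _)
    (m'.triangle f).1 (m'.triangle f).2.1 (m'.triangle f).2.2 (rel f 0) (rel f 1) (rel f 2)
  have zero := T.sum_corner_eq_zero (d := u' - u)
    (fun f => by rw [Fin.sum_univ_three]; exact (face f).1) hK f
  rw [Fin.sum_univ_three] at zero
  obtain ⟨h1, h2⟩ := (face f).2 zero
  fin_cases i <;> fin_cases j <;>
    first | rfl | exact h1 | exact h2 | exact h1.symm | exact h2.symm | exact h1.trans h2 |
      exact (h1.trans h2).symm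

theorem IsHyperbolicVertexScaling.sub_corner_eq_zero [Fintype V] [Fintype F] {l₀ l l' : E → ℝ}
    {u u' : V → ℝ} (h : T.IsHyperbolicVertexScaling l₀ u l)
    (h' : T.IsHyperbolicVertexScaling l₀ u' l') (hK : T.curvaturePH l' = T.curvaturePH l)
    (f : F) (i : Fin 3) : (u' - u) (T.corner f i) = 0 := by
  obtain ⟨-, m, e⟩ := h
  obtain ⟨-, m', e'⟩ := h'
  have rel : ∀ f i, Real.sinh (l' (T.side f i) / 2) = Real.sinh (l (T.side f i) / 2) *
      Real.exp (((u' - u) (T.corner f (i + 1)) + (u' - u) (T.corner f (i + 2))) / 2) := by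
    intro f i
    rw [e', e, exp_ends_side f i u u', mul_assoc]
  have face : ∀ f, _ := fun f => hyperbolicAngle_vertexScaling (m.1 _) (m.1 _) (m.1 _)
    (m.triangle f).1 (m.triangle f).2.1 (m.triangle f).2.2 (m'.1 _) (m'.1 _) (m'.1 _)
    (m'.triangle f).1 (m'.triangle f).2.1 (m'.triangle f).2.2 (rel f 0) (rel f 1) (rel f 2)
  have zero := T.sum_corner_eq_zero (d := u' - u)
    (fun f => by rw [Fin.sum_univ_three]; exact (face f).1) hK f
  rw [Fin.sum_univ_three] at zero
  obtain ⟨h1, h2, h3⟩ := (face f).2 zero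
  fin_cases i
  · exact h1
  · exact h2
  · exact h3

theorem IsDiscreteMetric.mul_const {l : E → ℝ} (h : T.IsDiscreteMetric l) {k : ℝ} (hk : 0 < k) :
    T.IsDiscreteMetric fun e => l e * k :=
  ⟨fun e => mul_pos (h.1 e) hk, fun f i => by
    rw [← add_mul]
    exact mul_lt_mul_of_pos_right (h.2 f i) hk⟩

/-- Both ends of an edge gain `t`, so the halved exponent gains exactly `t`: a global homothety. -/
theorem IsEuclideanVertexScaling.add_const {l₀ l : E → ℝ} {u u' : V → ℝ} {t : ℝ}
    (h : T.IsEuclideanVertexScaling l₀ u l) (ht : ∀ v, u' v = u v + t) :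
    T.IsEuclideanVertexScaling l₀ u' fun e => l e * Real.exp t := by
  refine ⟨h.1, h.2.1.mul_const (Real.exp_pos t), fun e => ?_⟩
  beta_reduce
  rw [h.2.2, mul_assoc, ← Real.exp_add, ht, ht]
  ring_nf

theorem curvaturePL_mul_const [Fintype F] (l : E → ℝ) {k : ℝ} (hk : 0 < k) :
    T.curvaturePL (fun e => l e * k) = T.curvaturePL l := by
  funext v
  simp only [curvaturePL, curvature, euclideanAngle_scale hk]

end Rigidity

end SurfaceTriangulation

theorem theorem1p2 {V E F M : Type*} [Fintype V] [Fintype E] [Fintype F]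
    [TopologicalSpace M] [ChartedSpace (EuclideanSpace ℝ (Fin 2)) M]
    [CompactSpace M] [T2Space M] [ConnectedSpace M]
    (T : SurfaceTriangulation V E F M) :
    (∀ (l₀ l : E → ℝ) (u : V → ℝ), T.IsEuclideanVertexScaling l₀ u l →
      ∀ u' : V → ℝ,
        (∃ l' : E → ℝ, T.IsEuclideanVertexScaling l₀ u' l' ∧
          T.curvaturePL l' = T.curvaturePL l) ↔
        ∃ t : ℝ, ∀ v, u' v = u v + t) ∧
    (∀ (l₀ l l' : E → ℝ) (u u' : V → ℝ),
      T.IsHyperbolicVertexScaling l₀ u l → T.IsHyperbolicVertexScaling l₀ u' l' →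
      T.curvaturePH l' = T.curvaturePH l → u' = u) := by
  refine ⟨fun l₀ l u h u' => ⟨?_, ?_⟩, fun l₀ l l' u u' h h' hK => funext fun v => ?_⟩
  · rintro ⟨l', h', hK⟩
    obtain ⟨p⟩ := (inferInstance : Nonempty M)
    obtain ⟨f, -, -⟩ := T.faces_cover p
    refine ⟨(u' - u) (T.corner f 0), fun v => ?_⟩
    rw [← T.eq_of_forall_corner_eq (u' - u) (h.sub_corner_eq h' hK) v (T.corner f 0)]
    simp
  · rintro ⟨t, ht⟩
    exact ⟨_, h.add_const ht,
      SurfaceTriangulation.curvaturePL_mul_const l (Real.exp_pos t)⟩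
  · obtain ⟨f, i, rfl⟩ := T.exists_corner_eq v
    exact sub_eq_zero.1 (h.sub_corner_eq_zero h' hK f i)
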